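/- All graphs are simple. For a graph $G$ and $n \ge 1$ let $G^n$ be its $n$-th Cartesian power: its vertices are the $n$-tuples of vertices of $G$, and two tuples are adjacent if and only if they are adjacent in $G$ in exactly one coordinate and equal in all other coordinates. Let $P_l$ denote the path on $l$ vertices, and let $Q_k = (P_2)^k$ denote the $k$-dimensional hypercube. Let $H$ be (isomorphic to) an induced subgraph of $Q_k$ for some $k$, and let $|H|$ be its number of vertices. Then there is an $N$ such that for every $n \ge N$ the vertex set of $(P_{2|H|})^n$ can be partitioned into sets each of which induces a subgraph of $(P_{2|H|})^n$ isomorphic to $H$. -/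

import Mathlib

namespace CubeTiling

/-- The `n`-th Cartesian power `G × ⋯ × G`: vertices are `n`-tuples of vertices of `G`, and two
tuples are adjacent iff they are adjacent in one coordinate and agree in all the others. -/
def cartesianPower {V : Type*} (G : SimpleGraph V) (n : ℕ) : SimpleGraph (Fin n → V) where
  Adj x y := ∃ i, G.Adj (x i) (y i) ∧ ∀ j, j ≠ i → x j = y j
  symm := ⟨fun _ _ ⟨i, hi, h⟩ => ⟨i, hi.symm, fun j hj => (h j hj).symm⟩⟩
  loopless := ⟨fun _ ⟨_, hi, _⟩ => hi.ne rfl⟩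

/-- The hypercube `Q_k`, the `k`-th Cartesian power of a single edge. -/
def hypercube (k : ℕ) : SimpleGraph (Fin k → Fin 2) :=
  cartesianPower (⊤ : SimpleGraph (Fin 2)) k

/-- The vertex set of `G` can be partitioned into vertex sets of induced copies of `H`. -/
def HasInducedPartition {V W : Type*} (H : SimpleGraph V) (G : SimpleGraph W) : Prop :=
  ∃ P : Set (Set W), Setoid.IsPartition P ∧ ∀ S ∈ P, Nonempty (H ≃g G.induce S)

end CubeTiling

open SimpleGraph

namespace CubeTiling

/-! ### Tileable sets -/

section

/-! Put h = |H| and P = P_{2h}. The tiling comes from two families of copies of H in P^k: one covers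
every vertex exactly h times (`sum_coverage_reflectedCopy`), the other 1 modulo h times
(`exists_one_mod_cover`), because the constant 1 lies in the span of the copies modulo h.

Extra coordinates remove the multiplicities. The h-fold cover yields two tileable sets covering a
power, and these yield a labelling of a power (`exists_star_labelling`). From it
`exists_exchangeable` builds sets D_i, E_j such that deleting any t + 1 of the D_i and any t of the
E_j leaves a tileable set. Each copy in the second family is placed over its own D_i, and
repetitions of the first family over the E_j. Over each vertex one more D than E is then used up, so
the rest is tileable (`exists_tileable_univ`). -/

/-- `U` is a finite disjoint union of vertex sets of induced copies of `H` in `G`. -/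
inductive Tileable {V W : Type*} (H : SimpleGraph V) (G : SimpleGraph W) : Set W → Prop
  | empty : Tileable H G ∅
  | copy (φ : H ↪g G) : Tileable H G (Set.range φ)
  | union {U U' : Set W} : Tileable H G U → Tileable H G U' → Disjoint U U' →
      Tileable H G (U ∪ U')

namespace Tileable

variable {V W A B : Type*} {H : SimpleGraph V} {G : SimpleGraph W}
  {G₁ : SimpleGraph A} {G₂ : SimpleGraph B}

theorem of_forall_not {p : W → Prop} (hp : ∀ x, ¬ p x) : Tileable H G {x | p x} := by
  have : {x | p x} = ∅ := by ext x; simp [hp x]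
  rw [this]; exact .empty

theorem congr {p q : W → Prop} (h : Tileable H G {x | p x}) (hpq : ∀ x, q x ↔ p x) :
    Tileable H G {x | q x} := by
  have : {x | q x} = {x | p x} := by ext x; exact hpq x
  rwa [this]

theorem split {p : W → Prop} (q : W → Prop) (h₁ : Tileable H G {x | p x ∧ q x})
    (h₂ : Tileable H G {x | p x ∧ ¬ q x}) : Tileable H G {x | p x} := by
  have : {x | p x} = {x | p x ∧ q x} ∪ {x | p x ∧ ¬ q x} := by
    ext x; simp only [Set.mem_ofPred_eq, Set.mem_union]; tauto
  rw [this]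
  refine h₁.union h₂ (Set.disjoint_left.2 ?_)
  rintro x ⟨-, hx⟩ ⟨-, hx'⟩
  exact hx' hx

theorem exists_mem {ι : Type*} (s : Finset ι) {p : ι → W → Prop}
    (h : ∀ i ∈ s, Tileable H G {x | p i x})
    (hd : ∀ i ∈ s, ∀ j ∈ s, ∀ x, p i x → p j x → i = j) :
    Tileable H G {x | ∃ i ∈ s, p i x} := by
  classical
  induction s using Finset.induction_on with
  | empty => exact of_forall_not (by simp)
  | insert a s ha ih =>
    refine split (p a) ?_ ?_
    · exact (h a (by simp)).congr fun x => ⟨And.right, fun hx => ⟨⟨a, by simp, hx⟩, hx⟩⟩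
    · refine (ih (fun i hi => h i (by simp [hi])) fun i hi j hj =>
        hd i (by simp [hi]) j (by simp [hj])).congr fun x => ⟨?_, ?_⟩
      · rintro ⟨⟨i, hi, hx⟩, hn⟩
        rcases Finset.mem_insert.1 hi with rfl | hi
        · exact absurd hx hn
        · exact ⟨i, hi, hx⟩
      · rintro ⟨i, hi, hx⟩
        refine ⟨⟨i, by simp [hi], hx⟩, fun hax => ha ?_⟩
        rwa [hd a (by simp) i (by simp [hi]) x hax hx]

theorem map {U : Set A} (h : Tileable H G₁ U) (f : G₁ ↪g G) : Tileable H G (f '' U) := by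
  induction h with
  | empty => simpa using Tileable.empty
  | copy φ =>
    rw [← Set.range_comp]
    exact .copy (f.comp φ)
  | union _ _ hd h₁ h₂ =>
    rw [Set.image_union]
    exact h₁.union h₂ ((Set.disjoint_image_iff f.injective).2 hd)

theorem of_fibers_fst [Finite B] {p : A × B → Prop}
    (h : ∀ b, Tileable H G₁ {a | p (a, b)}) : Tileable H (G₁ □ G₂) {x | p x} := by
  cases nonempty_fintype B
  refine (exists_mem (G := G₁ □ G₂) Finset.univ (p := fun b x => p x ∧ x.2 = b) (fun b _ => ?_)
    (fun i _ j _ x hi hj => hi.2.symm.trans hj.2)).congr (by simp)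
  have := (h b).map (boxProdLeft G₁ G₂ b)
  convert this using 1
  ext ⟨x, y⟩
  simp only [Set.mem_ofPred_eq, Set.mem_image, boxProdLeft_apply, Prod.mk.injEq]
  constructor
  · rintro ⟨hp, rfl⟩
    exact ⟨x, hp, rfl, rfl⟩
  · rintro ⟨a, ha, rfl, rfl⟩
    exact ⟨ha, rfl⟩

theorem of_fibers_snd [Finite A] {p : A × B → Prop}
    (h : ∀ a, Tileable H G₂ {b | p (a, b)}) : Tileable H (G₁ □ G₂) {x | p x} := by
  cases nonempty_fintype A
  refine (exists_mem (G := G₁ □ G₂) Finset.univ (p := fun a x => p x ∧ x.1 = a) (fun b _ => ?_)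
    (fun i _ j _ x hi hj => hi.2.symm.trans hj.2)).congr (by simp)
  have := (h b).map (boxProdRight G₁ G₂ b)
  convert this using 1
  ext ⟨x, y⟩
  simp only [Set.mem_ofPred_eq, Set.mem_image, boxProdRight_apply, Prod.mk.injEq]
  constructor
  · rintro ⟨hp, rfl⟩
    exact ⟨y, hp, rfl, rfl⟩
  · rintro ⟨a, ha, rfl, rfl⟩
    exact ⟨ha, rfl⟩

theorem and_const {p : W → Prop} (c : Prop) (h : c → Tileable H G {x | p x}) :
    Tileable H G {x | p x ∧ c} := by
  by_cases hc : c
  · exact (h hc).congr (by simp [hc])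
  · exact of_forall_not (by simp [hc])

theorem exists_partition [Nonempty V] {U : Set W} (h : Tileable H G U) :
    ∃ P : Set (Set W), ∅ ∉ P ∧ (∀ x ∈ U, ∃! S, S ∈ P ∧ x ∈ S) ∧ (∀ S ∈ P, S ⊆ U) ∧
      ∀ S ∈ P, Nonempty (H ≃g G.induce S) := by
  induction h with
  | empty => exact ⟨∅, by simp⟩
  | copy φ =>
    refine ⟨{Set.range φ}, ?_, ?_, by simp, ?_⟩
    · intro h
      exact (Set.range_nonempty φ).ne_empty (Set.mem_singleton_iff.1 h).symm
    · intro x hx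
      exact ⟨Set.range φ, ⟨rfl, hx⟩, fun S hS => hS.1⟩
    · rintro S rfl
      exact ⟨⟨Equiv.ofInjective φ φ.injective, by simp⟩⟩
  | @union U U' _ _ hd h₁ h₂ =>
    obtain ⟨P, hP0, hP, hPU, hPi⟩ := h₁
    obtain ⟨Q, hQ0, hQ, hQU, hQi⟩ := h₂
    refine ⟨P ∪ Q, ?_, ?_, ?_, ?_⟩
    · rintro (h | h)
      exacts [hP0 h, hQ0 h]
    · rintro x (hx | hx)
      · obtain ⟨S, hS, hu⟩ := hP x hx
        refine ⟨S, ⟨Or.inl hS.1, hS.2⟩, ?_⟩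
        rintro T ⟨hT | hT, hxT⟩
        · exact hu T ⟨hT, hxT⟩
        · exact absurd (hQU T hT hxT) (Set.disjoint_left.1 hd hx)
      · obtain ⟨S, hS, hu⟩ := hQ x hx
        refine ⟨S, ⟨Or.inr hS.1, hS.2⟩, ?_⟩
        rintro T ⟨hT | hT, hxT⟩
        · exact absurd hx (Set.disjoint_left.1 hd (hPU T hT hxT))
        · exact hu T ⟨hT, hxT⟩
    · rintro S (hS | hS)
      · exact (hPU S hS).trans Set.subset_union_left
      · exact (hQU S hS).trans Set.subset_union_right
    · rintro S (hS | hS)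
      exacts [hPi S hS, hQi S hS]

theorem hasInducedPartition [Nonempty V] (h : Tileable H G Set.univ) :
    HasInducedPartition H G := by
  obtain ⟨P, h0, h1, -, h3⟩ := h.exists_partition
  exact ⟨P, ⟨h0, fun x => h1 x trivial⟩, h3⟩

end Tileable

/-! ### Products of powers -/

/-- `G` is isomorphic to a Cartesian power of `P`. -/
def IsPower {α W : Type*} (P : SimpleGraph α) (G : SimpleGraph W) : Prop :=
  ∃ n, Nonempty (G ≃g cartesianPower P n)

/-- Concatenation of tuples identifies a product of two powers with a power. -/
def cartesianPowerAdd {α : Type*} (P : SimpleGraph α) (m n : ℕ) :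
    (cartesianPower P m □ cartesianPower P n) ≃g cartesianPower P (m + n) where
  toEquiv := Fin.appendEquiv m n
  map_rel_iff' := by
    rintro ⟨a, b⟩ ⟨c, d⟩
    simp only [boxProd_adj, cartesianPower, Fin.appendEquiv, Equiv.coe_fn_mk]
    constructor
    · rintro ⟨i, hi, h⟩
      induction i using Fin.addCases with
      | left i =>
        refine Or.inl ⟨⟨i, by simpa using hi, fun j hj => ?_⟩, funext fun j => ?_⟩
        · simpa using h (Fin.castAdd n j) (by simpa using hj)
        · simpa using h (Fin.natAdd m j) (by simp [Fin.ext_iff]; omega)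
      | right i =>
        refine Or.inr ⟨⟨i, by simpa using hi, fun j hj => ?_⟩, funext fun j => ?_⟩
        · simpa using h (Fin.natAdd m j) (by simpa using hj)
        · simpa using h (Fin.castAdd n j) (by simp [Fin.ext_iff]; omega)
    · rintro (⟨⟨i, hi, h⟩, rfl⟩ | ⟨⟨i, hi, h⟩, rfl⟩)
      · refine ⟨Fin.castAdd n i, by simpa using hi, fun j hj => ?_⟩
        induction j using Fin.addCases with
        | left j => simpa using h j (by rintro rfl; exact hj rfl)
        | right j => simp
      · refine ⟨Fin.natAdd m i, by simpa using hi, fun j hj => ?_⟩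
        induction j using Fin.addCases with
        | left j => simp
        | right j => simpa using h j (by rintro rfl; exact hj rfl)

/-- Isomorphic factors give isomorphic box products. -/
def boxProdCongr {A B C D : Type*} {G₁ : SimpleGraph A} {G₂ : SimpleGraph B} {G₃ : SimpleGraph C}
    {G₄ : SimpleGraph D} (e : G₁ ≃g G₃) (f : G₂ ≃g G₄) : (G₁ □ G₂) ≃g (G₃ □ G₄) where
  toEquiv := e.toEquiv.prodCongr f.toEquiv
  map_rel_iff' := by
    rintro ⟨a, b⟩ ⟨c, d⟩
    have h₁ : G₃.Adj (e a) (e c) ↔ G₁.Adj a c := e.map_rel_iff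
    have h₂ : G₄.Adj (f b) (f d) ↔ G₂.Adj b d := f.map_rel_iff
    simp [boxProd_adj, h₁, h₂]

theorem IsPower.boxProd {α A B : Type*} {P : SimpleGraph α} {G₁ : SimpleGraph A}
    {G₂ : SimpleGraph B} (h₁ : IsPower P G₁) (h₂ : IsPower P G₂) : IsPower P (G₁ □ G₂) := by
  obtain ⟨m, ⟨e⟩⟩ := h₁
  obtain ⟨n, ⟨f⟩⟩ := h₂
  exact ⟨m + n, ⟨(boxProdCongr e f).trans (cartesianPowerAdd P m n)⟩⟩

/-! ### From covers to labellings -/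

variable {V α : Type*} {H : SimpleGraph V} {P : SimpleGraph α}

/-- If finitely many tileable sets cover a power of `P`, then two tileable sets cover a larger
power. -/
theorem exists_two_tileable_cover (M : ℕ) {W : Type} [Finite W] (G : SimpleGraph W)
    (hG : IsPower P G) (A : ℕ → W → Prop) (hA : ∀ i, Tileable H G {x | A i x})
    (hc : ∀ x, ∃ i < M + 2, A i x) :
    ∃ (Y : Type) (_ : Finite Y) (G' : SimpleGraph Y), IsPower P G' ∧ ∃ B C : Y → Prop,
      Tileable H G' {x | B x} ∧ Tileable H G' {x | C x} ∧ ∀ x, B x ∨ C x := by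
  classical
  induction M generalizing W with
  | zero =>
    refine ⟨W, ‹_›, G, hG, A 0, A 1, hA 0, hA 1, fun x => ?_⟩
    obtain ⟨i, hi, h⟩ := hc x
    interval_cases i
    exacts [Or.inl h, Or.inr h]
  | succ M ih =>
    have key : ∀ (i : ℕ) (f : W → ℕ),
        Tileable H (G □ G) {x : W × W | A i x.1 ∨ A (f x.1) x.2} := by
      intro i f
      refine .split (fun x => A i x.1) ?_ ?_
      · exact .of_fibers_fst fun b => (hA i).congr fun x => by simp only; tauto
      · refine .of_fibers_snd fun a => ?_
        refine (Tileable.and_const (¬ A i a) fun _ => hA (f a)).congr fun x => ?_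
        simp only; tauto
    have key' : ∀ (i : ℕ) (f : W → ℕ),
        Tileable H (G □ G) {x : W × W | A i x.2 ∨ A (f x.2) x.1} := by
      intro i f
      refine .split (fun x => A i x.2) ?_ ?_
      · exact .of_fibers_snd fun b => (hA i).congr fun x => by simp only; tauto
      · refine .of_fibers_fst fun a => ?_
        refine (Tileable.and_const (¬ A i a) fun _ => hA (f a)).congr fun x => ?_
        simp only; tauto
    -- Squaring saves one set: `A 0`, `A 1`, `A 2` merge into two. The index used in one coordinate
    -- depends on the other, so every slice is still some `A i` or the whole union splits along `A
    -- i`.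
    refine ih (G □ G) (hG.boxProd hG) (fun j x => match j with
      | 0 => A 0 x.1 ∨ A (if A 1 x.1 then 2 else 0) x.2
      | 1 => A 1 x.2 ∨ A (if A 0 x.2 then 1 else 2) x.1
      | j + 2 => A (j + 3) x.1 ∨ A (j + 3) x.2) ?_ ?_
    · rintro (_ | _ | j)
      · exact key 0 fun x => if A 1 x then 2 else 0
      · exact key' 1 fun x => if A 0 x then 1 else 2
      · exact key (j + 3) fun _ => j + 3
    · rintro ⟨x, y⟩
      by_cases hj : ∃ j < M, A (j + 3) x ∨ A (j + 3) y
      · obtain ⟨j, hj, h⟩ := hj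
        exact ⟨j + 2, by omega, h⟩
      have small : ∀ z, (∀ j < M, ¬ A (j + 3) z) → A 0 z ∨ A 1 z ∨ A 2 z := by
        intro z hz
        obtain ⟨i, hi, h⟩ := hc z
        match i, hi, h with
        | 0, _, h => exact Or.inl h
        | 1, _, h => exact Or.inr (Or.inl h)
        | 2, _, h => exact Or.inr (Or.inr h)
        | i + 3, hi, h => exact absurd h (hz i (by omega))
      have hx := small x fun j hjM h => hj ⟨j, hjM, Or.inl h⟩
      have hy := small y fun j hjM h => hj ⟨j, hjM, Or.inr h⟩
      by_cases h0 : A 0 x ∨ A (if A 1 x then 2 else 0) y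
      · exact ⟨0, by omega, h0⟩
      · refine ⟨1, by omega, ?_⟩
        show A 1 y ∨ A (if A 0 y then 1 else 2) x
        split_ifs at h0 ⊢ <;> tauto

/-- A labelling with a co-tileable label class `0` that becomes tileable together with any one of
the label classes `1, …, d`. -/
theorem exists_star_labelling {Y : Type} [Finite Y] (G : SimpleGraph Y) (hG : IsPower P G)
    (B C : Y → Prop) (hB : Tileable H G {x | B x}) (hC : Tileable H G {x | C x})
    (hBC : ∀ x, B x ∨ C x) (d : ℕ) :
    ∃ (Z : Type) (_ : Finite Z) (G' : SimpleGraph Z), IsPower P G' ∧ ∃ l : Z → ℕ,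
      Tileable H G' {x | l x ≠ 0} ∧ ∀ i < d, Tileable H G' {x | l x = 0 ∨ l x = i + 1} := by
  classical
  induction d with
  | zero =>
    refine ⟨Y, ‹_›, G, hG, fun x => if B x then 1 else 0, ?_, by simp⟩
    exact hB.congr (by simp)
  | succ d ih =>
    obtain ⟨Z, hZ, G', hG', l, h0, hl⟩ := ih
    -- Off `B` the old labels survive, those above `d` moving up to free `d + 1`. Label 0 now means
    -- old label 0 and not `B`; adding the new class `d + 1` completes it to old label 0 and `C`, as
    -- `B` and `C` cover.
    let m : Z × Y → ℕ := fun x => if ¬ B x.2 then l x.1 + (if d < l x.1 then 1 else 0) else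
      if l x.1 = 0 ∧ C x.2 then d + 1 else d + 2
    refine ⟨Z × Y, inferInstance, G' □ G, hG'.boxProd hG, m, ?_, ?_⟩
    · refine .split (fun x => B x.2) ?_ ?_
      · refine .of_fibers_snd fun a => hB.congr fun x => ?_
        simp only [m]; split_ifs <;> simp_all
      · refine .of_fibers_fst fun b =>
          (Tileable.and_const (¬ B b) fun _ => h0).congr fun x => ?_
        simp only [m]; split_ifs <;> grind
    · intro i hi
      rcases Nat.lt_succ_iff_lt_or_eq.1 hi with hi | rfl
      · refine .of_fibers_fst fun b =>
          (Tileable.and_const (¬ B b) fun _ => hl i hi).congr fun x => ?_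
        simp only [m]; split_ifs <;> grind
      · refine .of_fibers_snd fun a =>
          (Tileable.and_const (l a = 0) fun _ => hC).congr fun x => ?_
        have := hBC x
        simp only [m]; split_ifs <;> grind

end

/-! ### Exchangeable sets -/

section

variable {V α : Type*} {H : SimpleGraph V} {P : SimpleGraph α}

theorem exists_injOn_erase {I J : Finset ℕ} (h : I.card = J.card + 1) :
    ∃ i₀ ∈ I, ∃ g : ℕ → ℕ, (∀ j ∈ J, g j ∈ I ∧ g j ≠ i₀) ∧
      (∀ j ∈ J, ∀ j' ∈ J, g j = g j' → j = j') ∧ ∀ i ∈ I, i ≠ i₀ → ∃ j ∈ J, g j = i := by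
  obtain ⟨i₀, hi₀⟩ : I.Nonempty := Finset.card_pos.1 (by omega)
  have hc : J.card = (I.erase i₀).card := by rw [Finset.card_erase_of_mem hi₀]; omega
  let e := Finset.equivOfCardEq hc
  refine ⟨i₀, hi₀, fun j => if hj : j ∈ J then e ⟨j, hj⟩ else 0, ?_, ?_, ?_⟩
  · intro j hj
    have := (e ⟨j, hj⟩).2
    rw [Finset.mem_erase] at this
    simpa [hj] using this.symm
  · intro j hj j' hj' h
    simp only [hj, hj', dif_pos] at h
    simpa using e.injective (Subtype.ext h)
  · intro i hi hne
    obtain ⟨⟨j, hj⟩, he⟩ := e.surjective ⟨i, Finset.mem_erase.2 ⟨hne, hi⟩⟩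
    exact ⟨j, hj, by simp [hj, he]⟩

/-- In a power of `P` there are `2d` disjoint sets `D i`, `E i` such that the complement of
any `t + 1` of the sets `D i` and any `t` of the sets `E i` is tileable. -/
theorem exists_exchangeable {Y : Type} [Finite Y] (G : SimpleGraph Y) (l : Y → ℕ) (d : ℕ)
    (h0 : Tileable H G {x | l x ≠ 0})
    (hl : ∀ i < d, Tileable H G {x | l x = 0 ∨ l x = i + 1}) (I J : Finset ℕ)
    (hI : ∀ i ∈ I, i < d) (hJ : ∀ i ∈ J, i < d) (hIJ : I.card = J.card + 1) :
    Tileable H (((G □ G) □ G) □ G) {x : ((Y × Y) × Y) × Y |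
      (¬ ∃ i ∈ I, l x.1.1.1 = i + 1 ∧ l x.1.1.2 = 0 ∧ l x.1.2 = 1 ∧ l x.2 = 0) ∧
      ¬ ∃ j ∈ J, l x.1.1.1 = 0 ∧ l x.1.1.2 = j + 1 ∧ l x.1.2 = 0 ∧ l x.2 = 0} := by
  obtain ⟨i₀, hi₀, g, hgI, hginj, hgsurj⟩ := exists_injOn_erase hIJ
  have hl0 : Tileable H G {x | l x = 0 ∨ l x = 1} := hl 0 (by have := hI _ hi₀; omega)
  let hole : (Y × Y) × Y → Prop := fun q => l q.1.1 = i₀ + 1 ∧ l q.1.2 = 0 ∧ l q.2 = 1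
  -- A path of four cells in label space from the projection of D_{g j} to that of E_j; consecutive
  -- cells differ in one coordinate, and their union is tileable along it.
  let lad : ℕ → (Y × Y) × Y → Prop := fun j q =>
    (l q.1.1 = g j + 1 ∧ l q.1.2 = 0 ∧ l q.2 = 1) ∨
    (l q.1.1 = g j + 1 ∧ l q.1.2 = j + 1 ∧ (l q.2 = 0 ∨ l q.2 = 1)) ∨
    (l q.1.1 = 0 ∧ l q.1.2 = j + 1 ∧ l q.2 = 0)
  -- the complement of a single hole
  have hhole : Tileable H ((G □ G) □ G) {q | ¬ hole q} := by
    refine .split (fun q => l q.1.2 ≠ 0) ?_ ?_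
    · refine .of_fibers_fst fun w => .of_fibers_snd fun x => h0.congr fun y => ?_
      simp only [hole]; tauto
    refine .split (fun q => l q.1.1 ≠ 0 ∧ l q.2 ≠ 0 ∧ l q.2 ≠ 1) ?_ ?_
    · refine .of_fibers_fst fun w => .of_fibers_fst fun y => ?_
      refine (Tileable.and_const (l y = 0 ∧ l w ≠ 0 ∧ l w ≠ 1) fun _ => h0).congr fun x => ?_
      simp only [hole]; tauto
    refine .split (fun q => l q.1.1 ≠ 0 ∧ l q.1.1 ≠ i₀ + 1) ?_ ?_
    · refine .of_fibers_snd fun q => ?_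
      refine (Tileable.and_const (l q.2 = 0 ∧ l q.1 ≠ 0 ∧ l q.1 ≠ i₀ + 1)
        fun _ => hl0).congr fun x => ?_
      simp only [hole]; tauto
    refine .split (fun q => l q.2 = 0) ?_ ?_
    · refine .of_fibers_fst fun w => .of_fibers_fst fun y => ?_
      refine (Tileable.and_const (l y = 0 ∧ l w = 0) fun _ => hl i₀ (hI _ hi₀)).congr fun x => ?_
      simp only [hole]; grind
    · refine .of_fibers_snd fun q => ?_
      refine (Tileable.and_const (l q.1 = 0 ∧ l q.2 = 0) fun _ => h0).congr fun w => ?_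
      simp only [hole]; grind
  refine .split (fun x => hole x.1) ?_ ?_
  · refine .of_fibers_snd fun q => (Tileable.and_const (hole q) fun _ => h0).congr fun z => ?_
    simp only [hole]; grind
  refine .split (fun x => l x.2 ≠ 0 ∧ l x.2 ≠ 1) ?_ ?_
  · refine .of_fibers_fst fun z =>
      (Tileable.and_const (l z ≠ 0 ∧ l z ≠ 1) fun _ => hhole).congr fun q => ?_
    simp only; grind
  refine .split (fun x => ¬ ∃ j ∈ J, lad j x.1) ?_ ?_
  · refine .of_fibers_snd fun q => (Tileable.and_const (¬ hole q ∧ ¬ ∃ j ∈ J, lad j q)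
      fun _ => hl0).congr fun z => ?_
    simp only [hole, lad]; grind
  -- Only the ladders at levels 0 and 1 remain. At level 0 both end cells are deleted, so the middle
  -- two are paired; at level 1 all four are present and paired first with second, third with
  -- fourth.
  refine (Tileable.exists_mem J (p := fun j (x : ((Y × Y) × Y) × Y) =>
    (l x.2 = 0 ∧ l x.1.1.1 = g j + 1 ∧ l x.1.1.2 = j + 1 ∧ (l x.1.2 = 0 ∨ l x.1.2 = 1)) ∨
    (l x.2 = 1 ∧ lad j x.1)) (fun j hj => ?_) ?_).congr ?_
  · refine .split (fun x => l x.2 = 0) ?_ ?_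
    · refine .of_fibers_fst fun z => .of_fibers_snd fun q => ?_
      refine (Tileable.and_const (l z = 0 ∧ l q.1 = g j + 1 ∧ l q.2 = j + 1)
        fun _ => hl0).congr fun w => ?_
      simp only [lad]; grind
    refine .split (fun x => l x.1.2 = 1) ?_ ?_
    · refine .of_fibers_fst fun z => .of_fibers_fst fun w => .of_fibers_snd fun x => ?_
      refine (Tileable.and_const (l z = 1 ∧ l w = 1 ∧ l x = g j + 1)
        fun _ => hl j (hJ j hj)).congr fun y => ?_
      simp only [lad]; grind
    · refine .of_fibers_fst fun z => .of_fibers_fst fun w => .of_fibers_fst fun y => ?_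
      refine (Tileable.and_const (l z = 1 ∧ l w = 0 ∧ l y = j + 1)
        fun _ => hl (g j) (hI _ (hgI j hj).1)).congr fun y => ?_
      simp only [lad]; grind
  · intro i hi j hj x
    have := hginj i hi j hj
    simp only [lad]; grind
  · rintro ⟨⟨⟨x, y⟩, w⟩, z⟩
    clear hhole h0 hl hl0 hI hJ hIJ
    constructor
    · rintro ⟨⟨⟨⟨hD, hE⟩, -⟩, hz⟩, hlad⟩
      obtain ⟨j, hj, hlad⟩ := not_not.1 hlad
      refine ⟨j, hj, ?_⟩
      have h1 := fun h => hD ⟨g j, (hgI j hj).1, h⟩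
      have h2 := fun h => hE ⟨j, hj, h⟩
      clear hD hE hgI hginj hgsurj
      simp only [lad] at hlad ⊢
      grind
    · rintro ⟨j, hj, h⟩
      have h1 : lad j ((x, y), w) ∧ (l z = 0 ∨ l z = 1) := by
        simp only [lad] at h ⊢; clear hgI hginj hgsurj; grind
      have hne := (hgI j hj).2
      clear hgI hginj hgsurj
      refine ⟨⟨⟨⟨?_, ?_⟩, ?_⟩, by simp only; omega⟩, not_not.2 ⟨j, hj, h1.1⟩⟩
      · rintro ⟨i, hi, hD⟩
        simp only at h hD; omega
      · rintro ⟨i, hi, hE⟩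
        simp only at h hE; omega
      · simp only [lad, hole] at h ⊢; omega

end

/-! ### Removing multiplicities -/

section

variable {V α : Type*} {H : SimpleGraph V} {P : SimpleGraph α}

open Classical in
theorem card_filter_range_mul (F : ℕ → Prop) (M t : ℕ) :
    ((Finset.range (M * t)).filter fun e => F (e % M)).card =
      t * ((Finset.range M).filter fun e => F e).card := by
  simp only [← Nat.count_eq_card_filter_range]
  induction t with
  | zero => simp
  | succ t ih =>
    rw [Nat.mul_succ, Nat.count_add, ih, Nat.succ_mul]
    congr 1
    simp only [Nat.count_eq_card_filter_range]
    congr 1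
    refine Finset.filter_congr fun e he => ?_
    rw [Nat.mul_add_mod, Nat.mod_eq_of_lt (Finset.mem_range.1 he)]

open Classical in
/-- If tileable sets cover every vertex of a power of `P` exactly `r` times, and other tileable
sets cover every vertex `1` modulo `r` times, then a larger power of `P` is tileable. -/
theorem exists_tileable_univ {W : Type} [Finite W] (G : SimpleGraph W) (hG : IsPower P G)
    {r : ℕ} (hr : 0 < r) (M L : ℕ) (F K : ℕ → W → Prop) (hF : ∀ i, Tileable H G {x | F i x})
    (hK : ∀ i, Tileable H G {x | K i x})
    (cF : ∀ b, ((Finset.range M).filter fun i => F i b).card = r) (c : W → ℕ)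
    (cK : ∀ a, ((Finset.range L).filter fun i => K i a).card = c a * r + 1) :
    ∃ n, Tileable H (cartesianPower P n) Set.univ := by
  obtain ⟨Y, _, G₁, hG₁, B, C, hB, hC, hBC⟩ := exists_two_tileable_cover M G hG F hF (by
    intro x
    have : 0 < ((Finset.range M).filter fun i => F i x).card := by rw [cF]; exact hr
    obtain ⟨i, hi⟩ := Finset.card_pos.1 this
    rw [Finset.mem_filter, Finset.mem_range] at hi
    exact ⟨i, by omega, hi.2⟩)
  obtain ⟨b, hb⟩ := (Set.finite_range c).bddAbove
  obtain ⟨Z, _, G', hG', l, h0, hl⟩ :=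
    exists_star_labelling G₁ hG₁ B C hB hC hBC (max L (M * b))
  let X := ((Z × Z) × Z) × Z
  let GX : SimpleGraph X := ((G' □ G') □ G') □ G'
  have hGX : IsPower P GX := ((hG'.boxProd hG').boxProd hG').boxProd hG'
  have key := exists_exchangeable G' l _ h0 hl
  let D : ℕ → X → Prop := fun i x => l x.1.1.1 = i + 1 ∧ l x.1.1.2 = 0 ∧ l x.1.2 = 1 ∧ l x.2 = 0
  let E : ℕ → X → Prop := fun j x => l x.1.1.1 = 0 ∧ l x.1.1.2 = j + 1 ∧ l x.1.2 = 0 ∧ l x.2 = 0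
  have hDE : ∀ i j x, D i x → E j x → False := by
    rintro i j x ⟨h, -⟩ ⟨h', -⟩
    omega
  suffices h : Tileable H (G □ (G □ GX)) {x : W × W × X | True} by
    obtain ⟨n, ⟨e⟩⟩ := hG.boxProd (hG.boxProd hGX)
    refine ⟨n, ?_⟩
    have h' := h.map e.toEmbedding
    convert h' using 1
    ext x
    simp only [Set.mem_univ, true_iff]
    exact ⟨e.symm x, trivial, e.apply_symm_apply x⟩
  refine .split (fun x => ∃ j ∈ Finset.range L, K j x.1 ∧ D j x.2.2) ?_ ?_
  · refine (Tileable.exists_mem (Finset.range L)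
      (p := fun j (x : W × W × X) => K j x.1 ∧ D j x.2.2) (fun j _ => ?_) ?_).congr (by simp)
    · exact .of_fibers_fst fun q => Tileable.and_const (D j q.2) fun _ => hK j
    · rintro i - j - x ⟨-, h, -⟩ ⟨-, h', -⟩
      omega
  refine .of_fibers_snd fun a => ?_
  -- With `a` fixed, `c a * r + 1` of the D sets are used. Repeating the `r`-fold cover `c a` times
  -- uses `c a * r` of the E sets over every `b'`, leaving the excess of one that `key` needs.
  refine .split (fun x => ∃ e ∈ Finset.range (M * c a), F (e % M) x.1 ∧ E e x.2) ?_ ?_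
  · refine (Tileable.exists_mem (Finset.range (M * c a))
      (p := fun e (x : W × X) => F (e % M) x.1 ∧ E e x.2) (fun j _ => ?_) ?_).congr ?_
    · exact .of_fibers_fst fun q => Tileable.and_const (E j q) fun _ => hF (j % M)
    · rintro i - j - x ⟨-, -, h, -⟩ ⟨-, -, h', -⟩
      omega
    · refine fun x => ⟨And.right, fun h => ⟨⟨trivial, ?_⟩, h⟩⟩
      rintro ⟨j, -, -, hD⟩
      obtain ⟨e, -, -, hE⟩ := h
      exact hDE _ _ _ hD hE
  refine .of_fibers_snd fun b' => ?_
  refine (key ((Finset.range L).filter fun i => K i a)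
    ((Finset.range (M * c a)).filter fun e => F (e % M) b') ?_ ?_ ?_).congr ?_
  · intro i hi
    simp only [Finset.mem_filter, Finset.mem_range] at hi
    exact lt_of_lt_of_le hi.1 (le_max_left _ _)
  · intro i hi
    simp only [Finset.mem_filter, Finset.mem_range] at hi
    exact lt_of_lt_of_le hi.1 ((Nat.mul_le_mul_left M (hb ⟨a, rfl⟩)).trans (le_max_right _ _))
  · rw [cK, card_filter_range_mul (fun e => F e b'), cF]
  · intro x
    simp only [Finset.mem_filter, true_and, D, E, and_assoc]

end

/-! ### Copies of H in powers of an even path -/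

section

/-- The embedding of the hypercube into a power of `P` that maps the `t`-th coordinate onto the
edge from `u t 0` to `u t 1`. -/
def cubeEmbedding {α : Type*} {P : SimpleGraph α} {k : ℕ} (u : Fin k → Fin 2 → α)
    (hu : ∀ t, P.Adj (u t 0) (u t 1)) : hypercube k ↪g cartesianPower P k :=
  have hadj : ∀ t a b, P.Adj (u t a) (u t b) ↔ a ≠ b := by
    intro t a b
    have := hu t
    fin_cases a <;> fin_cases b <;> simp [this, this.symm]
  have hinj : ∀ t a b, u t a = u t b ↔ a = b := by
    intro t a b
    refine ⟨fun h => ?_, fun h => by rw [h]⟩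
    by_contra hab
    exact ((hadj t a b).2 hab).ne h
  { toFun := fun x t => u t (x t)
    inj' := fun x y h => funext fun t => (hinj t _ _).1 (congrFun h t)
    map_rel_iff' := by
      intro x y
      show (∃ i, P.Adj (u i (x i)) (u i (y i)) ∧ ∀ j, j ≠ i → u j (x j) = u j (y j)) ↔
        ∃ i, x i ≠ y i ∧ ∀ j, j ≠ i → x j = y j
      simp only [hadj, hinj] }

variable {V : Type*} [Fintype V] {H : SimpleGraph V} {k : ℕ}

/-- The neighbour of `a` in the partition of a path of even length into edges. -/
def pathPartner {h : ℕ} (a : Fin (2 * h)) : Fin (2 * h) :=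
  ⟨if a.1 % 2 = 0 then a.1 + 1 else a.1 - 1, by split_ifs <;> omega⟩

theorem pathPartner_adj {h : ℕ} (a : Fin (2 * h)) : (pathGraph (2 * h)).Adj a (pathPartner a) := by
  simp only [pathGraph_adj, pathPartner]
  split_ifs <;> omega

theorem pathPartner_pathPartner {h : ℕ} (a : Fin (2 * h)) : pathPartner (pathPartner a) = a := by
  ext
  simp only [pathPartner]
  split_ifs <;> omega

/-- The multiplicity with which `φ` covers `x`. -/
def coverage {W R : Type*} [DecidableEq W] [Semiring R] (φ : V → W) (x : W) : R :=
  ∑ v, if φ v = x then 1 else 0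

theorem coverage_eq {W R : Type*} [DecidableEq W] [Semiring R] {φ : V → W}
    (hφ : Function.Injective φ) (x : W) :
    (coverage φ x : R) = if x ∈ Set.range φ then 1 else 0 := by
  classical
  rw [coverage]
  split_ifs with hx
  · obtain ⟨v, rfl⟩ := hx
    simp [hφ.eq_iff]
  · exact Finset.sum_eq_zero fun v _ => if_neg fun h => hx ⟨v, h⟩

/-- Copies of `H`, one for each vertex of a power of an even path, that cover each vertex equally
often. -/
def reflectedCopy {h : ℕ} (ι : H ↪g hypercube k) (v : Fin k → Fin (2 * h)) :
    H ↪g cartesianPower (pathGraph (2 * h)) k :=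
  (cubeEmbedding (fun t a => if a = 0 then v t else pathPartner (v t))
    (fun t => by simpa using pathPartner_adj (v t))).comp ι

/-- For a fixed vertex `p` of H, sending `v` to the image of `p` is an involution (partners are
swapped where `ι p t ≠ 0`), so each `p` hits `x` exactly once. -/
theorem sum_coverage_reflectedCopy {h : ℕ} (ι : H ↪g hypercube k) (x : Fin k → Fin (2 * h)) :
    ∑ v, (coverage (reflectedCopy ι v) x : ℕ) = Fintype.card V := by
  simp only [coverage]
  rw [Finset.sum_comm]
  simp only [Finset.sum_boole]
  rw [Finset.sum_eq_card_nsmul (b := 1), smul_eq_mul, mul_one, Finset.card_univ]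
  intro p _
  simp only [Nat.cast_id]
  rw [Finset.card_eq_one]
  refine ⟨fun t => if ι p t = 0 then x t else pathPartner (x t), ?_⟩
  ext v
  simp only [Finset.mem_filter, Finset.mem_univ, true_and, Finset.mem_singleton, funext_iff]
  refine forall_congr' fun t => ?_
  show (if ι p t = 0 then v t else pathPartner (v t)) = x t ↔ _
  split_ifs
  · rfl
  · constructor
    · intro h; rw [← h, pathPartner_pathPartner]
    · intro h; rw [h, pathPartner_pathPartner]

/-- The additive group of functions modulo `h` generated by the copies of `H`. -/
def copySpan (H : SimpleGraph V) {W : Type*} [DecidableEq W] (G : SimpleGraph W) (h : ℕ) :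
    AddSubgroup (W → ZMod h) :=
  AddSubgroup.closure (Set.range fun φ : H ↪g G => coverage φ)

/-- Place `v₀` at `a t` or `b t` in coordinate `t`, sending the opposite cube value to `c t`, and
take the alternating sum over all choices. Any other vertex differs from `v₀` in some coordinate,
where its position ignores the choice, so its terms cancel. -/
theorem prod_sub_mem_copySpan {α : Type*} [DecidableEq α] {P : SimpleGraph α}
    (ι : H ↪g hypercube k) (v₀ : V) (h : ℕ) (a b c : Fin k → α)
    (ha : ∀ t, P.Adj (c t) (a t)) (hb : ∀ t, P.Adj (c t) (b t)) :
    (fun x : Fin k → α => ∏ t, ((if a t = x t then 1 else 0) - if b t = x t then 1 else 0)) ∈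
      copySpan H (cartesianPower P k) h := by
  let s := ι v₀
  let u : (Fin k → Fin 2) → Fin k → Fin 2 → α := fun ε t i =>
    if i = s t then (if ε t = 0 then a t else b t) else c t
  have hu : ∀ ε t, P.Adj (u ε t 0) (u ε t 1) := by
    intro ε t
    have hA : P.Adj (c t) (if ε t = 0 then a t else b t) := by
      split_ifs
      exacts [ha t, hb t]
    by_cases hs : s t = 0
    · have : (1 : Fin 2) ≠ s t := by rw [hs]; decide
      simpa [u, hs, this] using hA.symm
    · have : (1 : Fin 2) = s t := by omega
      simpa [u, ← this] using hA
  let φ : (Fin k → Fin 2) → H ↪g cartesianPower P k := fun ε => (cubeEmbedding (u ε) (hu ε)).comp ι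
  have hmem : (∑ ε : Fin k → Fin 2, (∏ t, (-1 : ℤ) ^ (ε t : ℕ)) • (coverage (φ ε) : _ → ZMod h)) ∈
      copySpan H (cartesianPower P k) h :=
    sum_mem fun ε _ => zsmul_mem (AddSubgroup.subset_closure (Set.mem_range_self (φ ε))) _
  convert hmem using 1
  ext x
  have hfac : ∀ v : V, ∑ ε : Fin k → Fin 2, (∏ t, (-1 : ZMod h) ^ (ε t : ℕ)) *
      (if φ ε v = x then 1 else 0) =
      ∏ t, ∑ e : Fin 2, (-1 : ZMod h) ^ (e : ℕ) *
        if (if ι v t = s t then (if e = 0 then a t else b t) else c t) = x t then 1 else 0 := by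
    intro v
    rw [Fintype.prod_sum]
    refine Finset.sum_congr rfl fun ε _ => ?_
    rw [Finset.prod_mul_distrib]
    congr 1
    rw [Finset.prod_ite_zero]
    simp only [Finset.prod_const_one, Finset.mem_univ, true_implies, funext_iff]
    rfl
  simp only [Finset.sum_apply, Pi.smul_apply]
  simp only [zsmul_eq_mul, Int.cast_prod, Int.cast_pow, Int.cast_neg, Int.cast_one, coverage,
    Finset.mul_sum]
  rw [Finset.sum_comm]
  simp only [hfac]
  rw [Finset.sum_eq_single v₀]
  · refine Finset.prod_congr rfl fun t _ => ?_
    simp only [s, Fin.sum_univ_two, sub_eq_add_neg]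
    split_ifs <;> simp_all
  · intro v _ hv
    have : ∃ t, ι v t ≠ s t := by
      by_contra! hcon
      exact hv (ι.injective (funext hcon))
    obtain ⟨t, ht⟩ := this
    refine Finset.prod_eq_zero (Finset.mem_univ t) ?_
    simp [ht, Fin.sum_univ_two]
  · simp

end

/-! ### Covers modulo |H| and the conclusion -/

section

theorem hasInducedPartition_of_le {V : Type*} [Nonempty V] {H : SimpleGraph V} {α : Type*} [Finite α] {P : SimpleGraph α} {m n : ℕ}
    (hmn : m ≤ n) (h : Tileable H (cartesianPower P m) Set.univ) :
    HasInducedPartition H (cartesianPower P n) := by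
  obtain ⟨d, rfl⟩ := Nat.exists_eq_add_of_le hmn
  have h' : Tileable H (cartesianPower P m □ cartesianPower P d) {_x | True} :=
    .of_fibers_fst fun b => h
  have h'' := h'.map (cartesianPowerAdd P m d).toEmbedding
  refine Tileable.hasInducedPartition ?_
  convert h'' using 1
  ext x
  simp only [Set.mem_univ, true_iff]
  exact ⟨(cartesianPowerAdd P m d).symm x, trivial, (cartesianPowerAdd P m d).apply_symm_apply x⟩

variable {V : Type*} [Fintype V] {H : SimpleGraph V} {k : ℕ}

/-- The sum telescopes: `a` gets a/2 + 1 from the first terms and loses a/2 to the second. At the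
last two vertices the first term is missing, but its weight would be h = 0; hence the path length
2h. -/
theorem sum_path_differences {h : ℕ} (a : Fin (2 * h)) :
    ∑ u : Fin (2 * h - 2), ((u.1 / 2 + 1 : ℕ) : ZMod h) *
      ((if (⟨u.1, by omega⟩ : Fin (2 * h)) = a then 1 else 0) -
        if (⟨u.1 + 2, by omega⟩ : Fin (2 * h)) = a then 1 else 0) = 1 := by
  have h₁ : ∑ u : Fin (2 * h - 2), ((u.1 / 2 + 1 : ℕ) : ZMod h) *
      (if (⟨u.1, by omega⟩ : Fin (2 * h)) = a then 1 else 0) = ((a.1 / 2 + 1 : ℕ) : ZMod h) := by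
    by_cases ha : a.1 < 2 * h - 2
    · rw [Finset.sum_eq_single ⟨a.1, ha⟩]
      · simp
      · intro b _ hb
        rw [if_neg, mul_zero]
        simpa [Fin.ext_iff] using hb
      · simp
    · have : a.1 / 2 + 1 = h := by omega
      rw [this, ZMod.natCast_self]
      refine Finset.sum_eq_zero fun u _ => ?_
      rw [if_neg, mul_zero]
      simp only [Fin.ext_iff]; omega
  have h₂ : ∑ u : Fin (2 * h - 2), ((u.1 / 2 + 1 : ℕ) : ZMod h) *
      (if (⟨u.1 + 2, by omega⟩ : Fin (2 * h)) = a then 1 else 0) = ((a.1 / 2 : ℕ) : ZMod h) := by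
    by_cases ha : 2 ≤ a.1
    · rw [Finset.sum_eq_single ⟨a.1 - 2, by omega⟩]
      · rw [if_pos (by simp only [Fin.ext_iff]; omega), mul_one]
        congr 1
        simp only; omega
      · intro b _ hb
        rw [if_neg, mul_zero]
        simp only [ne_eq, Fin.ext_iff] at hb ⊢
        omega
      · simp
    · have : a.1 / 2 = 0 := by omega
      rw [this, Nat.cast_zero]
      refine Finset.sum_eq_zero fun u _ => ?_
      rw [if_neg, mul_zero]
      simp only [Fin.ext_iff]; omega
  simp only [mul_sub, Finset.sum_sub_distrib]
  rw [h₁, h₂]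
  push_cast
  ring

theorem one_mem_copySpan {h : ℕ} (ι : H ↪g hypercube k) (v₀ : V) :
    (1 : (Fin k → Fin (2 * h)) → ZMod h) ∈
      copySpan H (cartesianPower (pathGraph (2 * h)) k) h := by
  let f : (Fin k → Fin (2 * h - 2)) → (Fin k → Fin (2 * h)) → ZMod h := fun U x =>
    ∏ t, ((if (⟨(U t).1, by omega⟩ : Fin (2 * h)) = x t then 1 else 0) -
      if (⟨(U t).1 + 2, by omega⟩ : Fin (2 * h)) = x t then 1 else 0)
  have hf : ∀ U, f U ∈ copySpan H (cartesianPower (pathGraph (2 * h)) k) h := fun U =>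
    prod_sub_mem_copySpan (P := pathGraph (2 * h)) ι v₀ h
      (fun t => ⟨(U t).1, by omega⟩) (fun t => ⟨(U t).1 + 2, by omega⟩)
      (fun t => ⟨(U t).1 + 1, by omega⟩) (fun t => by simp [pathGraph_adj])
      (fun t => by simp [pathGraph_adj])
  have hmem : ∑ U, (∏ t, ((U t).1 / 2 + 1)) • f U ∈
      copySpan H (cartesianPower (pathGraph (2 * h)) k) h :=
    sum_mem fun U _ => nsmul_mem (hf U) _
  convert hmem using 1
  ext x
  simp only [Finset.sum_apply, Pi.smul_apply]
  simp only [f, nsmul_eq_mul, Nat.cast_prod, ← Finset.prod_mul_distrib]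
  rw [← Fintype.prod_sum (fun t (u : Fin (2 * h - 2)) => ((u.1 / 2 + 1 : ℕ) : ZMod h) *
      ((if (⟨u.1, by omega⟩ : Fin (2 * h)) = x t then 1 else 0) -
        if (⟨u.1 + 2, by omega⟩ : Fin (2 * h)) = x t then 1 else 0))]
  simp only [sum_path_differences, Finset.prod_const_one, Pi.one_apply]

open Classical in
theorem exists_tileable_family {W : Type*} [DecidableEq W] {G : SimpleGraph W} (l : List (H ↪g G)) :
    ∃ K : ℕ → W → Prop, (∀ i, Tileable H G {x | K i x}) ∧
      ∀ x, ((Finset.range l.length).filter fun i => K i x).card =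
        (l.map fun φ : H ↪g G => (coverage φ x : ℕ)).sum := by
  induction l with
  | nil => exact ⟨fun _ _ => False, fun _ => .of_forall_not (by simp), by simp⟩
  | cons φ l ih =>
    obtain ⟨K, hK, hc⟩ := ih
    refine ⟨fun i x => match i with
      | 0 => x ∈ Set.range φ
      | i + 1 => K i x, ?_, ?_⟩
    · rintro (_ | i)
      · exact .copy φ
      · exact hK i
    · intro x
      rw [List.map_cons, List.sum_cons, ← hc, coverage_eq φ.injective, Finset.card_filter,
        List.length_cons, Finset.sum_range_succ', Finset.card_filter, add_comm]
      refine congrArg₂ (· + ·) ?_ rfl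
      by_cases hx : x ∈ Set.range φ
      · exact (if_pos hx).trans (if_pos hx).symm
      · exact (if_neg hx).trans (if_neg hx).symm

theorem exists_one_mod_cover [Nonempty V] (ι : H ↪g hypercube k) :
    ∃ l : List (H ↪g cartesianPower (pathGraph (2 * Fintype.card V)) k), ∀ x, ∃ c,
      (l.map fun φ : H ↪g cartesianPower (pathGraph (2 * Fintype.card V)) k =>
        (coverage φ x : ℕ)).sum = c * Fintype.card V + 1 := by
  have hpos : 0 < Fintype.card V := Fintype.card_pos
  have : NeZero (Fintype.card V) := ⟨hpos.ne'⟩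
  have h1 := one_mem_copySpan (h := Fintype.card V) ι (Classical.arbitrary V)
  -- In a finite group negatives are multiples, so only nonnegative combinations are needed.
  rw [copySpan, ← AddSubgroup.mem_toAddSubmonoid, AddSubgroup.closure_toAddSubmonoid_of_finite]
    at h1
  obtain ⟨l', hl', hsum⟩ := AddSubmonoid.exists_list_of_mem_closure h1
  obtain ⟨l, rfl⟩ : l' ∈ Set.range (List.map fun φ :
      H ↪g cartesianPower (pathGraph (2 * Fintype.card V)) k =>
        (coverage φ : _ → ZMod (Fintype.card V))) := by
    rw [Set.range_list_map]
    exact hl'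
  -- The extra full cover changes nothing modulo |H| but keeps the count positive; for |H| = 1 the
  -- list `l` alone could give 0.
  refine ⟨l ++ Finset.univ.toList.map (reflectedCopy ι), fun x => ?_⟩
  have hcast : ∀ l : List (H ↪g cartesianPower (pathGraph (2 * Fintype.card V)) k),
      (((l.map fun φ : H ↪g cartesianPower (pathGraph (2 * Fintype.card V)) k =>
          (coverage φ x : ℕ)).sum : ℕ) : ZMod (Fintype.card V)) =
        (l.map fun φ : H ↪g cartesianPower (pathGraph (2 * Fintype.card V)) k =>
          (coverage φ : _ → ZMod (Fintype.card V))).sum x := by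
    intro l
    induction l with
    | nil => simp
    | cons φ l ih =>
      simp only [List.map_cons, List.sum_cons, Nat.cast_add, ih, Pi.add_apply]
      simp [coverage]
  rw [List.map_append, List.sum_append, List.map_map]
  have hr : ((Finset.univ.toList.map ((fun φ : H ↪g cartesianPower (pathGraph (2 * Fintype.card V)) k =>
      (coverage φ x : ℕ)) ∘ reflectedCopy ι))).sum =
      Fintype.card V := by
    rw [Finset.sum_map_toList]
    exact sum_coverage_reflectedCopy ι x
  rw [hr]
  have hm := hcast l
  rw [hsum, Pi.one_apply] at hm
  set N := (l.map fun φ : H ↪g cartesianPower (pathGraph (2 * Fintype.card V)) k =>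
    (coverage φ x : ℕ)).sum
  have hdvd : Fintype.card V ∣ N + Fintype.card V - 1 := by
    rw [← ZMod.natCast_eq_zero_iff, Nat.cast_sub (by omega)]
    simp [hm]
  obtain ⟨c, hc⟩ := hdvd
  refine ⟨c, ?_⟩
  rw [mul_comm] at hc
  omega

end

end CubeTiling

theorem theorem2p1 {V : Type*} (H : SimpleGraph V) (k : ℕ)
    (hH : H.IsIndContained (CubeTiling.hypercube k)) :
    ∃ N : ℕ, ∀ n : ℕ, N ≤ n →
      CubeTiling.HasInducedPartition H
        (CubeTiling.cartesianPower (SimpleGraph.pathGraph (2 * Nat.card V)) n) := by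
  obtain ⟨ι⟩ := hH
  have : Finite V := Finite.of_injective ι ι.injective
  cases nonempty_fintype V
  rw [Nat.card_eq_fintype_card]
  rcases isEmpty_or_nonempty V with hV | hV
  -- The path is empty here, so its powers with `n ≥ 1` have no vertices; the power 0 still has one.
  · refine ⟨1, fun n hn => ⟨∅, ⟨by simp, fun a => ?_⟩, by simp⟩⟩
    have h0 : Fintype.card V = 0 := Fintype.card_eq_zero
    have := (a ⟨0, hn⟩).2
    omega
  · obtain ⟨l, hl⟩ := CubeTiling.exists_one_mod_cover ι
    choose c hc using hl
    obtain ⟨K, hK, hKc⟩ := CubeTiling.exists_tileable_family l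
    obtain ⟨F, hF, hFc⟩ := CubeTiling.exists_tileable_family
      (Finset.univ.toList.map (CubeTiling.reflectedCopy (h := Fintype.card V) ι))
    obtain ⟨m, hm⟩ := CubeTiling.exists_tileable_univ
      (CubeTiling.cartesianPower (SimpleGraph.pathGraph (2 * Fintype.card V)) k)
      ⟨k, ⟨SimpleGraph.Iso.refl⟩⟩ (r := Fintype.card V) Fintype.card_pos _ _ F K hF hK
      (fun b => (hFc b).trans (by
        rw [List.map_map, Finset.sum_map_toList]
        exact CubeTiling.sum_coverage_reflectedCopy ι b)) c
      (fun a => (hKc a).trans (hc a))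
    exact ⟨m, fun n hn => CubeTiling.hasInducedPartition_of_le hn hm⟩
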